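/- Let $0<\mathfrak h<H<1$ and let $B^H=(B^H_t)_{t\ge 0}$ be a fractional Brownian motion with Hurst parameter $H$ on a probability space, i.e. a centered Gaussian process starting from $0$, with $\mathbf E\big[(B^H_t-B^H_s)^2\big]=|t-s|^{2H}$ for all $s,t\ge 0$ and with almost surely continuous paths. For $T>0$ put $$\|B^H\|_{0,T,\mathfrak h}=\sup_{0\le s,t\le T,\ s\ne t}\frac{|B^H_t-B^H_s|}{|t-s|^{\mathfrak h}}\in[0,\infty].$$ Write $[z]$ for the integer part of $z\ge 0$ and $n!!$ for the double factorial, so that $n!!=n(n-2)(n-4)\cdots$ ends with $1$ or $2$. Then: 1. For every $T>0$, $\|B^H\|_{0,T,\mathfrak h}<\infty$ almost surely. 2. For every $T>T_0:=\big(\mathfrak h/(8H)\big)^{1/(H-\mathfrak h)}$, the random variable $\exp(\|B^H\|_{0,T,\mathfrak h})$ is integrable and $$\mathbf E\Big[\exp\big(\|B^H\|_{0,T,\mathfrak h}\big)\Big]\le c_{H,\mathfrak h}\,\big(1+T^{H-\mathfrak h}\big)\,\exp\Big(\frac{128H^2}{\mathfrak h^2}\,T^{2(H-\mathfrak h)}\Big),\qquad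 c_{H,\mathfrak h}=\Big[\frac{2}{H-\mathfrak h}\Big]!!+\frac{16H}{\mathfrak h}.$$ 3. For every $T>0$ and every integer $p>\big[2/(H-\mathfrak h)\big]$, the random variable $\|B^H\|_{0,T,\mathfrak h}^p$ is integrable and $$\mathbf E\Big[\|B^H\|_{0,T,\mathfrak h}^p\Big]\le\Big(\frac{16H}{\mathfrak h}\Big)^p\,T^{p(H-\mathfrak h)}\,(p-1)!!.$$ -/

import Mathlib

open MeasureTheory ProbabilityTheory
open scoped ENNReal NNReal Nat

/-- `B = (B_t)_{t ≥ 0}` is a fractional Brownian motion with Hurst parameter `H` under `P`: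
a centered Gaussian process starting from `0`, with `E (B_t - B_s)² = |t - s|^(2H)` and with
almost surely continuous paths. -/
structure IsFractionalBrownianMotion {Ω : Type*} [MeasurableSpace Ω]
    (B : ℝ≥0 → Ω → ℝ) (H : ℝ) (P : Measure Ω) : Prop where
  isGaussianProcess : IsGaussianProcess B P
  centered : ∀ t, ∫ ω, B t ω ∂P = 0
  start_zero : ∀ᵐ ω ∂P, B 0 ω = 0
  integral_sq_sub : ∀ s t : ℝ≥0,
    ∫ ω, (B t ω - B s ω) ^ 2 ∂P = |(t : ℝ) - (s : ℝ)| ^ (2 * H)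
  continuous_paths : ∀ᵐ ω ∂P, Continuous fun t => B t ω

/-- The `γ`-Hölder (semi)norm on `[0, T]` of a path `f`, with values in `[0, ∞]`:
the supremum of `|f t - f s| / |t - s|^γ` over `0 ≤ s, t ≤ T`
(pairs with `s = t` contribute `0`, also by the convention `0 / 0 = 0`). -/
noncomputable def holderNorm (f : ℝ≥0 → ℝ) (T : ℝ≥0) (γ : ℝ) : ℝ≥0∞ :=
  ⨆ s ∈ Set.Icc 0 T, ⨆ t ∈ Set.Icc 0 T,
    ENNReal.ofReal (|f t - f s| / |(t : ℝ) - (s : ℝ)| ^ γ)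

/-!
The Hölder norm is controlled pathwise by a double integral whose expectation is computed from the
Gaussian moments of the increments.

Fix an integer `p > 2 / (H - h)` and set `α = H - 2 / p`, so that `h < α`. For a continuous path `g`
let `A` be the integral of `|g x - g y| ^ p / |x - y| ^ (p H)` over `[0, T]²`
(`slobodeckijEnergy`). By Jensen's inequality, the means of `g` over an interval of length `ℓ` and
over a subinterval of length `ℓ r` differ by at most `A ^ (1 / p) r ^ (-1 / p) ℓ ^ α`
(`abs_integral_cond_sub_le`). Along intervals that shrink geometrically to either end of `[s, t]`
the means converge to `g s` and `g t`, and the errors form a geometric series. The ratio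
`r = 2 ^ (-1 / H)` gives `|g t - g s| ≤ 8 (H / α) A ^ (1 / p) |t - s| ^ α`
(`abs_sub_le_of_slobodeckijEnergy_le`), hence a bound of the `p`-th power of the `h`-Hölder norm by
`(8 H / h) ^ p T ^ (p (H - h) - 2) A` (`holderNorm_pow_le`).

For fractional Brownian motion `E |B_t - B_s| ^ p ≤ |t - s| ^ (p H) (p - 1)‼`, so Tonelli's theorem
gives `E A ≤ T² (p - 1)‼`. It is applied to a jointly measurable version with continuous paths
(`exists_measurable_continuous_version`). This proves finiteness and the bound on the moments.

For the exponential moment put `K = 16 (H / h) T ^ (H - h)` and `m = ⌊2 / (H - h)⌋₊`. The terms of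
order `n > m` of the exponential series are at most `K ^ n (n - 1)‼ / n! = K ^ n / n‼`, with sum at
most `(1 + K) exp (K² / 2)`. In the remaining terms `y ^ n ≤ 1 + y ^ (m + 1)`, with `y` the Hölder
norm divided by `K`, gives the bound `(1 + m‼) K ^ n / n!`, with sum at most `(1 + m‼) exp K`
(`lintegral_exp_le_of_moments`). The condition on `T` says that `K > 2`, so `exp K ≤ exp (K² / 2)`.
-/

open Filter Topology

/-! ### Absolute moments of Gaussian variables -/

/-- The absolute moments of the standard Gaussian law in terms of the Gamma function. -/
theorem lintegral_abs_pow_gaussianReal_eq (p : ℕ) :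
    ∫⁻ x, ENNReal.ofReal (|x| ^ p) ∂(gaussianReal 0 1) =
      ENNReal.ofReal (2 ^ ((p : ℝ) / 2) * Real.Gamma (((p : ℝ) + 1) / 2) / √Real.pi) := by
  have hint : Integrable (fun x : ℝ => |x| ^ p) (gaussianReal 0 1) := by
    have := (memLp_id_gaussianReal' (μ := 0) (v := 1) (p : ℝ≥0∞) (by simp)).integrable_norm_pow'
    simpa using this
  rw [← ofReal_integral_eq_lintegral_ofReal hint (by filter_upwards with x; positivity)]
  congr 1
  rw [integral_gaussianReal_eq_integral_smul one_ne_zero]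
  have h1 : ∀ x : ℝ, gaussianPDFReal 0 1 x • |x| ^ p =
      (fun y : ℝ => (√(2 * Real.pi))⁻¹ * (y ^ (p : ℝ) * Real.exp (-(1 / 2) * y ^ (2 : ℝ)))) |x| := by
    intro x
    simp [gaussianPDFReal]
    ring_nf
  simp_rw [h1]
  rw [integral_comp_abs (f := fun y : ℝ => (√(2 * Real.pi))⁻¹ *
    (y ^ (p : ℝ) * Real.exp (-(1 / 2) * y ^ (2 : ℝ)))), integral_const_mul,
    integral_rpow_mul_exp_neg_mul_rpow (by norm_num) (by linarith [p.cast_nonneg (α := ℝ)])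
      (by norm_num)]
  have h2 : ((1 : ℝ) / 2) ^ (-((p : ℝ) + 1) / 2) = √2 * 2 ^ ((p : ℝ) / 2) := by
    rw [one_div, Real.inv_rpow (by norm_num), ← Real.rpow_neg (by norm_num), Real.sqrt_eq_rpow,
      ← Real.rpow_add (by norm_num)]
    congr 1; ring
  rw [h2, Real.sqrt_mul (by norm_num)]
  have : √Real.pi ≠ 0 := by positivity
  field_simp

/-- By the recursion `Γ (x + 1) = x Γ (x)` both sides are multiplied by `p + 1` when `p` is replaced
by `p + 2`; at `p = 1` the left side is `√(2 / π)`. -/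
theorem two_rpow_mul_Gamma_le_doubleFactorial : ∀ p : ℕ,
    2 ^ ((p : ℝ) / 2) * Real.Gamma (((p : ℝ) + 1) / 2) / √Real.pi ≤ ((p - 1) ‼ : ℕ)
  | 0 => by
    have : √Real.pi ≠ 0 := by positivity
    have h : Real.Gamma (2⁻¹) = √Real.pi := by rw [← one_div]; exact Real.Gamma_one_half_eq
    simp [h, this]
  | 1 => by
    norm_num [← Real.sqrt_eq_rpow]
    exact div_le_one_of_le₀ (Real.sqrt_le_sqrt Real.two_le_pi) (by positivity)
  | p + 2 => by
    have ih := two_rpow_mul_Gamma_le_doubleFactorial p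
    have h1 : (((p + 2 : ℕ) : ℝ) + 1) / 2 = ((p : ℝ) + 1) / 2 + 1 := by push_cast; ring
    have h2 : (((p + 2 : ℕ) : ℝ)) / 2 = (p : ℝ) / 2 + 1 := by push_cast; ring
    rw [h1, h2, Real.Gamma_add_one (by positivity), Real.rpow_add (by norm_num), Real.rpow_one,
      show p + 2 - 1 = p + 1 by omega, Nat.doubleFactorial_add_one]
    push_cast
    calc _ = ((p : ℝ) + 1) * (2 ^ ((p : ℝ) / 2) * Real.Gamma (((p : ℝ) + 1) / 2) / √Real.pi) := by
          ring
      _ ≤ _ := by gcongr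

/-- The absolute moments of a centered Gaussian variable with standard deviation `σ`. For even `p`
this is an equality; for odd `p` it drops a factor `√(2 / π)`. -/
theorem lintegral_abs_pow_le_of_hasGaussianLaw {Ω : Type*} [MeasurableSpace Ω] {P : Measure Ω}
    {X : Ω → ℝ} (hX : HasGaussianLaw X P) (h0 : ∫ ω, X ω ∂P = 0) {σ : ℝ} (hσ : 0 ≤ σ)
    (h2 : ∫ ω, X ω ^ 2 ∂P = σ ^ 2) (p : ℕ) :
    ∫⁻ ω, ENNReal.ofReal (|X ω| ^ p) ∂P ≤ ENNReal.ofReal (σ ^ p * ((p - 1) ‼ : ℕ)) := by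
  have hm : AEMeasurable X P := hX.aemeasurable
  have hv : Var[X; P] = σ ^ 2 := by
    rw [variance_of_integral_eq_zero hm h0, h2]
  have hmap : P.map X = (gaussianReal 0 1).map (fun x => σ * x) := by
    rw [gaussianReal_map_const_mul, hX.map_eq_gaussianReal, h0, hv]
    congr 1
    · simp
    · ext; simp [sq_nonneg]
  rw [← lintegral_map' (f := fun x => ENNReal.ofReal (|x| ^ p)) (by fun_prop) hm, hmap,
    lintegral_map (by fun_prop) (by fun_prop)]
  have : ∀ x : ℝ, ENNReal.ofReal (|σ * x| ^ p) =
      ENNReal.ofReal (σ ^ p) * ENNReal.ofReal (|x| ^ p) := by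
    intro x
    rw [abs_mul, abs_of_nonneg hσ, mul_pow, ENNReal.ofReal_mul (by positivity)]
  simp_rw [this]
  rw [lintegral_const_mul _ (by fun_prop), lintegral_abs_pow_gaussianReal_eq,
    ENNReal.ofReal_mul (by positivity)]
  gcongr
  exact two_rpow_mul_Gamma_le_doubleFactorial p

/-! ### Pathwise bound of the Hölder norm by a double integral -/

/-- Jensen's inequality for `x ↦ |c - x| ^ p`. -/
theorem enorm_sub_integral_pow_le {Ω : Type*} [MeasurableSpace Ω] {μ : Measure Ω}
    [IsProbabilityMeasure μ] {u : Ω → ℝ} (hu : Integrable u μ) (c : ℝ) {p : ℕ} (hp : 1 ≤ p) :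
    ‖c - ∫ x, u x ∂μ‖ₑ ^ p ≤ ∫⁻ x, ‖c - u x‖ₑ ^ p ∂μ := by
  have h1 : c - ∫ x, u x ∂μ = ∫ x, (c - u x) ∂μ := by
    rw [integral_sub (integrable_const c) hu]; simp
  have hm : AEStronglyMeasurable (fun x => c - u x) μ := by
    exact ((integrable_const c).sub hu).aestronglyMeasurable
  have h2 := eLpNorm_le_eLpNorm_of_exponent_le (μ := μ) (p := 1) (q := (p : ℝ≥0∞))
    (by exact_mod_cast hp) hm
  have h3 : eLpNorm (fun x => c - u x) p μ ^ p = ∫⁻ x, ‖c - u x‖ₑ ^ p ∂μ := by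
    have hp0 : (p : ℝ) ≠ 0 := by exact_mod_cast (by omega : p ≠ 0)
    rw [eLpNorm_eq_lintegral_rpow_enorm_toReal (by exact_mod_cast (by omega : p ≠ 0)) (by simp),
      ← ENNReal.rpow_natCast, ← ENNReal.rpow_mul]
    simp [hp0]
  rw [h1, ← h3]
  gcongr
  refine le_trans (enorm_integral_le_lintegral_enorm _) ?_
  rwa [eLpNorm_one_eq_lintegral_enorm] at h2

/-- The means of a continuous function over intervals that contain `c` and shrink to it
converge to its value at `c`. -/
theorem tendsto_integral_cond_of_continuous {g : ℝ → ℝ} (hg : Continuous g) {c : ℝ} {a ℓ : ℕ → ℝ}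
    (hℓ : ∀ k, 0 < ℓ k) (hℓ0 : Tendsto ℓ atTop (𝓝 0))
    (hc : ∀ k, c ∈ Set.Icc (a k) (a k + ℓ k)) :
    Tendsto (fun k => ∫ x, g x ∂volume[|Set.Icc (a k) (a k + ℓ k)]) atTop (𝓝 (g c)) := by
  rw [Metric.tendsto_atTop]
  intro ε hε
  obtain ⟨δ, hδ, h⟩ := Metric.continuous_iff.1 hg c (ε / 2) (by positivity)
  obtain ⟨N, hN⟩ := (hℓ0.eventually (gt_mem_nhds hδ)).exists_forall_of_atTop
  refine ⟨N, fun k hk => ?_⟩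
  have hvol : volume (Set.Icc (a k) (a k + ℓ k)) ≠ 0 := by simp [hℓ k]
  have hprob : IsProbabilityMeasure volume[|Set.Icc (a k) (a k + ℓ k)] :=
    cond_isProbabilityMeasure_of_finite hvol (by simp)
  have hi : Integrable g volume[|Set.Icc (a k) (a k + ℓ k)] :=
    (hg.continuousOn.integrableOn_compact isCompact_Icc).smul_measure (by simp [hℓ k])
  have h1 : (∫ x, g x ∂volume[|Set.Icc (a k) (a k + ℓ k)]) - g c =
      ∫ x, (g x - g c) ∂volume[|Set.Icc (a k) (a k + ℓ k)] := by
    rw [integral_sub hi (integrable_const _)]; simp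
  rw [Real.dist_eq, h1]
  have h2 : ∀ᵐ x ∂volume[|Set.Icc (a k) (a k + ℓ k)], ‖g x - g c‖ ≤ ε / 2 := by
    filter_upwards [ae_cond_mem measurableSet_Icc] with x hx
    rw [← dist_eq_norm]
    refine (h x ?_).le
    have := hN k hk
    have := hc k
    rw [Real.dist_eq, abs_lt]
    constructor <;> linarith [hx.1, hx.2, this.1, this.2]
  have := norm_integral_le_of_norm_le_const h2
  simp only [Real.norm_eq_abs, probReal_univ, mul_one] at this
  linarith

/-- The double integral of `|g x - g y| ^ p / |x - y| ^ (p H)` over `[0, T]²`, the `p`-th power of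
the Gagliardo–Slobodeckij seminorm of order `H - 1 / p`. For `p ≥ 1` the integrand is zero on the
diagonal, a null set, so that the convention for division by zero is harmless. -/
noncomputable def slobodeckijEnergy (g : ℝ → ℝ) (T : ℝ) (p : ℕ) (H : ℝ) : ℝ≥0∞ :=
  ∫⁻ x in Set.Icc 0 T, ∫⁻ y in Set.Icc 0 T,
    ENNReal.ofReal (|g x - g y| ^ p / |x - y| ^ ((p : ℝ) * H))

/-- The basic estimate: on nested intervals of lengths `ℓ * r` and `ℓ` the means of `g` differ by
at most a multiple of `ℓ ^ (H - 2 / p)`. Jensen's inequality in both variables bounds the `p`-th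
power of the difference by the mean of `|g x - g y| ^ p`, where `|x - y| ≤ ℓ`. -/
theorem abs_integral_cond_sub_le {g : ℝ → ℝ} (hg : Continuous g) {T H M : ℝ} {p : ℕ} (hp : 1 ≤ p)
    (hH : 0 < H) (hM : 0 ≤ M) (hE : slobodeckijEnergy g T p H ≤ ENNReal.ofReal (M ^ p)) {a b ℓ r : ℝ}
    (hr : 0 < r) (hℓ : 0 < ℓ)
    (hJI : Set.Icc b (b + ℓ * r) ⊆ Set.Icc a (a + ℓ)) (hI : Set.Icc a (a + ℓ) ⊆ Set.Icc 0 T) :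
    |(∫ x, g x ∂volume[|Set.Icc a (a + ℓ)]) - ∫ x, g x ∂volume[|Set.Icc b (b + ℓ * r)]| ≤
      M * r ^ (-(1 / (p : ℝ))) * ℓ ^ (H - 2 / p) := by
  have hp0 : (0 : ℝ) < p := by exact_mod_cast hp
  set I := Set.Icc a (a + ℓ) with hIdef
  set J := Set.Icc b (b + ℓ * r) with hJdef
  have hvI : volume I = ENNReal.ofReal ℓ := by simp [hIdef]
  have hvJ : volume J = ENNReal.ofReal (ℓ * r) := by simp [hJdef]
  have hℓr : 0 < ℓ * r := by positivity
  have hI0 : volume I ≠ 0 := by simp [hvI, hℓ]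
  have hJ0 : volume J ≠ 0 := by rw [hvJ]; simp [hℓr]
  have : IsProbabilityMeasure volume[|I] :=
    cond_isProbabilityMeasure_of_finite hI0 (by simp [hvI])
  have : IsProbabilityMeasure volume[|J] :=
    cond_isProbabilityMeasure_of_finite hJ0 (by simp [hvJ])
  have hiI : Integrable g volume[|I] :=
    (hg.continuousOn.integrableOn_compact isCompact_Icc).smul_measure (by simp [hI0])
  have hiJ : Integrable g volume[|J] :=
    (hg.continuousOn.integrableOn_compact isCompact_Icc).smul_measure (by simp [hJ0])
  -- on the diagonal both sides are zero, because `p ≠ 0`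
  have key : ∀ x ∈ I, ∀ y ∈ J, ‖g x - g y‖ₑ ^ p ≤ ENNReal.ofReal (ℓ ^ ((p : ℝ) * H)) *
      ENNReal.ofReal (|g x - g y| ^ p / |x - y| ^ ((p : ℝ) * H)) := by
    intro x hx y hy
    rw [← ENNReal.ofReal_mul (by positivity), Real.enorm_eq_ofReal_abs,
      ← ENNReal.ofReal_pow (abs_nonneg _)]
    apply ENNReal.ofReal_le_ofReal
    rcases eq_or_ne x y with rfl | hxy
    · simp [zero_pow (by omega : p ≠ 0)]
    have hd : 0 < |x - y| := abs_pos.2 (sub_ne_zero.2 hxy)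
    have hdl : |x - y| ≤ ℓ := by
      have := hJI hy
      rw [abs_le]; constructor <;> linarith [hx.1, hx.2, this.1, this.2]
    rw [← mul_div_assoc, le_div_iff₀ (by positivity), mul_comm]
    gcongr
  have hen : ‖(∫ x, g x ∂volume[|I]) - ∫ x, g x ∂volume[|J]‖ₑ ^ p ≤
      (ENNReal.ofReal ℓ)⁻¹ * ((ENNReal.ofReal (ℓ * r))⁻¹ *
        (ENNReal.ofReal (ℓ ^ ((p : ℝ) * H)) * ENNReal.ofReal (M ^ p))) := by
    calc _ = ‖(∫ y, g y ∂volume[|J]) - ∫ x, g x ∂volume[|I]‖ₑ ^ p := by rw [enorm_sub_rev]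
      _ ≤ ∫⁻ x, ‖(∫ y, g y ∂volume[|J]) - g x‖ₑ ^ p ∂volume[|I] :=
          enorm_sub_integral_pow_le hiI _ hp
      _ = ∫⁻ x, ‖g x - ∫ y, g y ∂volume[|J]‖ₑ ^ p ∂volume[|I] := by
          simp_rw [enorm_sub_rev]
      _ ≤ ∫⁻ x, ∫⁻ y, ‖g x - g y‖ₑ ^ p ∂volume[|J] ∂volume[|I] :=
          lintegral_mono fun x => enorm_sub_integral_pow_le hiJ _ hp
      _ = (ENNReal.ofReal ℓ)⁻¹ * ((ENNReal.ofReal (ℓ * r))⁻¹ *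
            ∫⁻ x in I, ∫⁻ y in J, ‖g x - g y‖ₑ ^ p) := by
          simp only [ProbabilityTheory.cond, lintegral_smul_measure, hvI, hvJ, smul_eq_mul]
          rw [lintegral_const_mul']
          simp [hℓr]
      _ ≤ (ENNReal.ofReal ℓ)⁻¹ * ((ENNReal.ofReal (ℓ * r))⁻¹ *
            ∫⁻ x in I, ∫⁻ y in J, ENNReal.ofReal (ℓ ^ ((p : ℝ) * H)) *
              ENNReal.ofReal (|g x - g y| ^ p / |x - y| ^ ((p : ℝ) * H))) := by
          refine mul_le_mul_right (mul_le_mul_right ?_ _) _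
          exact setLIntegral_mono' measurableSet_Icc fun x hx =>
            setLIntegral_mono' measurableSet_Icc fun y hy => key x hx y hy
      _ = (ENNReal.ofReal ℓ)⁻¹ * ((ENNReal.ofReal (ℓ * r))⁻¹ * (ENNReal.ofReal (ℓ ^ ((p : ℝ) * H)) *
            ∫⁻ x in I, ∫⁻ y in J,
              ENNReal.ofReal (|g x - g y| ^ p / |x - y| ^ ((p : ℝ) * H)))) := by
          simp_rw [lintegral_const_mul' _ _ ENNReal.ofReal_ne_top]
      _ ≤ _ := by
          refine mul_le_mul_right (mul_le_mul_right (mul_le_mul_right ?_ _) _) _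
          refine le_trans ?_ hE
          refine (lintegral_mono fun x => lintegral_mono_set (hJI.trans hI)).trans ?_
          exact lintegral_mono_set hI
  set X := (∫ x, g x ∂volume[|I]) - ∫ x, g x ∂volume[|J]
  rw [← ENNReal.ofReal_inv_of_pos hℓ, ← ENNReal.ofReal_inv_of_pos hℓr,
    ← ENNReal.ofReal_mul (by positivity), ← ENNReal.ofReal_mul (by positivity),
    ← ENNReal.ofReal_mul (by positivity), Real.enorm_eq_ofReal_abs,
    ← ENNReal.ofReal_pow (abs_nonneg _), ENNReal.ofReal_le_ofReal_iff (by positivity)] at hen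
  refine (pow_le_pow_iff_left₀ (abs_nonneg _) (by positivity) (by omega : p ≠ 0)).1
    (hen.trans_eq ?_)
  have e1 : (r ^ (-(1 / (p : ℝ)))) ^ p = r⁻¹ := by
    rw [← Real.rpow_natCast, ← Real.rpow_mul hr.le, ← Real.rpow_neg_one]
    congr 1; field_simp
  have e2 : (ℓ ^ (H - 2 / (p : ℝ))) ^ p = ℓ ^ ((p : ℝ) * H) / ℓ ^ 2 := by
    rw [← Real.rpow_natCast, ← Real.rpow_mul hℓ.le, ← Real.rpow_natCast, ← Real.rpow_sub hℓ]
    congr 1; push_cast; field_simp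
  rw [mul_pow, mul_pow, e1, e2]
  field_simp

/-- The basic estimate summed along nested intervals of lengths `d * r ^ k` around `c`. -/
theorem abs_integral_cond_sub_apply_le {g : ℝ → ℝ} (hg : Continuous g) {T H M : ℝ} {p : ℕ}
    (hH : 0 < H) (hpH : 2 < p * H) (hM : 0 ≤ M)
    (hE : slobodeckijEnergy g T p H ≤ ENNReal.ofReal (M ^ p)) {c d r : ℝ} {a : ℕ → ℝ}
    (hr : 0 < r) (hr1 : r < 1) (hd : 0 < d)
    (hnest : ∀ k, Set.Icc (a (k + 1)) (a (k + 1) + d * r ^ (k + 1)) ⊆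
      Set.Icc (a k) (a k + d * r ^ k))
    (hsub : ∀ k, Set.Icc (a k) (a k + d * r ^ k) ⊆ Set.Icc 0 T)
    (hc : ∀ k, c ∈ Set.Icc (a k) (a k + d * r ^ k)) :
    |(∫ x, g x ∂volume[|Set.Icc (a 0) (a 0 + d)]) - g c| ≤
      M * r ^ (-(1 / (p : ℝ))) * d ^ (H - 2 / p) / (1 - r ^ (H - 2 / p)) := by
  have hp : 1 ≤ p := by
    rcases Nat.eq_zero_or_pos p with rfl | h
    · norm_num at hpH
    · exact h
  have hp0 : (0 : ℝ) < p := by exact_mod_cast hp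
  have hα : 0 < H - 2 / p := by
    rw [sub_pos, div_lt_iff₀ hp0]; linarith
  have hlim := tendsto_integral_cond_of_continuous hg (c := c) (a := a) (ℓ := fun k => d * r ^ k)
    (fun k => by positivity)
    (by simpa using (tendsto_pow_atTop_nhds_zero_of_lt_one hr.le hr1).const_mul d) hc
  have := dist_le_of_le_geometric_of_tendsto₀ (r ^ (H - 2 / p))
    (M * r ^ (-(1 / (p : ℝ))) * d ^ (H - 2 / p)) (Real.rpow_lt_one hr.le hr1 hα) (fun k => ?_) hlim
  · simpa [Real.dist_eq] using this
  · have h := abs_integral_cond_sub_le hg hp hH hM hE (a := a k) (b := a (k + 1)) (ℓ := d * r ^ k)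
      (r := r) hr (by positivity) (by simpa [pow_succ, mul_assoc] using hnest k) (hsub k)
    rw [Real.dist_eq, pow_succ, ← mul_assoc]
    refine h.trans_eq ?_
    rw [Real.mul_rpow hd.le (by positivity), ← Real.rpow_natCast r k, ← Real.rpow_mul hr.le,
      ← Real.rpow_natCast (r ^ (H - 2 / (p : ℝ))), ← Real.rpow_mul hr.le]
    ring_nf

/-- A form of the Garsia–Rodemich–Rumsey inequality for powers, with the constant
`8 * (H / (H - 2 / p))`. -/
theorem abs_sub_le_of_slobodeckijEnergy_le {g : ℝ → ℝ} (hg : Continuous g) {T H M : ℝ} {p : ℕ}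
    (hH : 0 < H) (hpH : 2 < p * H) (hM : 0 ≤ M)
    (hE : slobodeckijEnergy g T p H ≤ ENNReal.ofReal (M ^ p)) {s t : ℝ} (hs : 0 ≤ s) (hst : s < t)
    (ht : t ≤ T) :
    |g t - g s| ≤ 8 * (H / (H - 2 / p)) * M * (t - s) ^ (H - 2 / p) := by
  have hp0 : (0 : ℝ) < p := by
    by_contra h
    have : (p : ℝ) = 0 := le_antisymm (not_lt.1 h) p.cast_nonneg
    rw [this] at hpH; linarith
  set α := H - 2 / (p : ℝ) with hαdef
  have hα : 0 < α := by
    rw [hαdef, sub_pos, div_lt_iff₀ hp0]; linarith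
  have hαH : α ≤ H := by
    have : 0 < 2 / (p : ℝ) := by positivity
    linarith
  have hd : 0 < t - s := sub_pos.2 hst
  -- the exponent `1 / H` makes `1 - r ^ α` at least `α / (2 * H)`, so that the constant is
  -- a multiple of `H / α` even for small `H`
  set r : ℝ := 2 ^ (-(1 / H)) with hrdef
  have hr : 0 < r := by positivity
  have hr1 : r < 1 := Real.rpow_lt_one_of_one_lt_of_neg (by norm_num) (by simp [hH])
  have hrk : ∀ k : ℕ, 0 < r ^ k := fun k => by positivity
  have hrk1 : ∀ k : ℕ, r ^ k ≤ 1 := fun k => pow_le_one₀ hr.le hr1.le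
  have hrs : ∀ k : ℕ, (t - s) * r ^ (k + 1) ≤ (t - s) * r ^ k := fun k => by
    gcongr (t - s) * ?_
    exact pow_le_pow_of_le_one hr.le hr1.le (Nat.le_succ k)
  have hrd : ∀ k : ℕ, (t - s) * r ^ k ≤ t - s := fun k => by
    nlinarith [hrk1 k]
  have hpos : ∀ k : ℕ, 0 < (t - s) * r ^ k := fun k => mul_pos hd (hrk k)
  have b1 := abs_integral_cond_sub_apply_le hg hH hpH hM hE (c := s) (d := t - s) (r := r)
    (a := fun _ => s) hr hr1 hd
    (fun k => Set.Icc_subset_Icc le_rfl (by linarith [hrs k]))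
    (fun k => Set.Icc_subset_Icc hs (by linarith [hrd k]))
    (fun k => ⟨le_rfl, by linarith [hpos k]⟩)
  have b2 := abs_integral_cond_sub_apply_le hg hH hpH hM hE (c := t) (d := t - s) (r := r)
    (a := fun k => t - (t - s) * r ^ k) hr hr1 hd
    (fun k => Set.Icc_subset_Icc (by linarith [hrs k]) (by linarith))
    (fun k => Set.Icc_subset_Icc (by linarith [hrd k]) (by linarith))
    (fun k => ⟨by linarith [hpos k], by linarith⟩)
  have e : t - (t - s) * r ^ 0 = s := by ring
  simp only [e] at b2
  rw [← hαdef] at b1 b2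
  -- this uses `1 < p * H`; the factor `r ^ (-1 / p)` is the cost of averaging over a shorter interval
  have c1 : r ^ (-(1 / (p : ℝ))) ≤ 2 := by
    rw [hrdef, ← Real.rpow_mul (by norm_num)]
    calc (2 : ℝ) ^ (-(1 / H) * -(1 / (p : ℝ))) ≤ 2 ^ (1 : ℝ) := by
          gcongr
          · norm_num
          · rw [neg_mul_neg, one_div_mul_one_div, div_le_one (by positivity)]
            linarith
      _ = 2 := by simp
  have c2 : α / (2 * H) ≤ 1 - r ^ α := by
    have h := rpow_one_add_le_one_add_mul_self (s := -(1 / 2)) (by norm_num)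
      (p := α / H) (by positivity) ((div_le_one hH).2 hαH)
    have e : r ^ α = (1 + -(1 / 2) : ℝ) ^ (α / H) := by
      rw [hrdef, ← Real.rpow_mul (by norm_num), show (1 + -(1 / 2) : ℝ) = 2⁻¹ by norm_num,
        Real.inv_rpow (by norm_num), ← Real.rpow_neg (by norm_num)]
      congr 1; ring
    rw [e]
    have : α / (2 * H) = α / H * (1 / 2) := by field_simp
    linarith
  have c3 : M * r ^ (-(1 / (p : ℝ))) * (t - s) ^ α / (1 - r ^ α) ≤
      M * 2 * (t - s) ^ α / (α / (2 * H)) := by gcongr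
  have c4 : M * 2 * (t - s) ^ α / (α / (2 * H)) = 4 * (H / α) * M * (t - s) ^ α := by
    field_simp; ring
  calc |g t - g s| = |((∫ x, g x ∂volume[|Set.Icc s (s + (t - s))]) - g s) -
        ((∫ x, g x ∂volume[|Set.Icc s (s + (t - s))]) - g t)| := by congr 1; ring
    _ ≤ _ := abs_sub _ _
    _ ≤ _ := by linarith

theorem holderNorm_pow_le {f : ℝ≥0 → ℝ} (hf : Continuous f) {T : ℝ≥0} (hT : 0 < T) {H h : ℝ}
    {p : ℕ} (hh : 0 < h) (hhH : h < H) (hp : 2 / (H - h) < p) :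
    holderNorm f T h ^ p ≤
      ENNReal.ofReal ((8 * (H / h)) ^ p * (T : ℝ) ^ ((p : ℝ) * (H - h) - 2)) *
        slobodeckijEnergy (fun x => f x.toNNReal) T p H := by
  have hHh : 0 < H - h := sub_pos.2 hhH
  have hH : 0 < H := hh.trans hhH
  have hp0 : (0 : ℝ) < p := lt_trans (by positivity) hp
  have hp1 : p ≠ 0 := by rintro rfl; simp at hp0
  have hT' : (0 : ℝ) < T := by exact_mod_cast hT
  have hpH' : 2 < p * (H - h) := (div_lt_iff₀ hHh).1 hp
  have hpH : 2 < p * H := by nlinarith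
  have hα : h < H - 2 / p := by
    have : 2 / (p : ℝ) < H - h := by rw [div_lt_iff₀ hp0]; linarith
    linarith
  set g : ℝ → ℝ := fun x => f x.toNNReal with hgdef
  have hg : Continuous g := hf.comp continuous_real_toNNReal
  set A := slobodeckijEnergy g T p H with hA
  rcases eq_or_ne A ∞ with hAt | hAt
  · rw [hAt, ENNReal.mul_top]
    · exact le_top
    · simp only [ne_eq, ENNReal.ofReal_eq_zero, not_le]
      positivity
  set M : ℝ := A.toReal ^ (1 / (p : ℝ)) with hMdef
  have hM : 0 ≤ M := by positivity
  have hMp : M ^ p = A.toReal := by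
    rw [hMdef, ← Real.rpow_natCast, ← Real.rpow_mul (by positivity), one_div_mul_cancel hp0.ne',
      Real.rpow_one]
  have hE : slobodeckijEnergy g T p H ≤ ENNReal.ofReal (M ^ p) := by
    rw [hMp, ENNReal.ofReal_toReal hAt]
  set C : ℝ := 8 * (H / h) * M * (T : ℝ) ^ (H - 2 / p - h) with hC
  have hlt : ∀ s t : ℝ≥0, s < t → t ≤ T → |f t - f s| / |(t : ℝ) - s| ^ h ≤ C := by
    intro s t hst htT
    have hst' : (s : ℝ) < t := by exact_mod_cast hst
    have htT' : (t : ℝ) ≤ T := by exact_mod_cast htT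
    have hd : 0 < (t : ℝ) - s := sub_pos.2 hst'
    have hb := abs_sub_le_of_slobodeckijEnergy_le hg hH hpH hM hE s.coe_nonneg hst' htT'
    simp only [hgdef, Real.toNNReal_coe] at hb
    rw [abs_of_pos hd, div_le_iff₀ (by positivity)]
    refine hb.trans ?_
    have e : ((t : ℝ) - s) ^ (H - 2 / (p : ℝ)) =
        ((t : ℝ) - s) ^ (H - 2 / (p : ℝ) - h) * ((t : ℝ) - s) ^ h := by
      rw [← Real.rpow_add hd]; congr 1; ring
    rw [e, hC, ← mul_assoc]
    have : ((t : ℝ) - s) ^ (H - 2 / (p : ℝ) - h) ≤ (T : ℝ) ^ (H - 2 / (p : ℝ) - h) :=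
      Real.rpow_le_rpow hd.le (by linarith [s.coe_nonneg]) (by linarith)
    gcongr
  have hC0 : 0 ≤ C := by positivity
  have hle : holderNorm f T h ≤ ENNReal.ofReal C := by
    refine iSup₂_le fun s hs => iSup₂_le fun t ht => ENNReal.ofReal_le_ofReal ?_
    rcases lt_trichotomy s t with hst | rfl | hst
    · exact hlt s t hst ht.2
    · simpa using hC0
    · rw [abs_sub_comm, abs_sub_comm (t : ℝ)]
      exact hlt t s hst hs.2
  calc holderNorm f T h ^ p ≤ ENNReal.ofReal C ^ p := by gcongr
    _ = ENNReal.ofReal ((8 * (H / h)) ^ p * (T : ℝ) ^ ((p : ℝ) * (H - h) - 2)) *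
        ENNReal.ofReal A.toReal := by
      rw [← ENNReal.ofReal_pow hC0, ← ENNReal.ofReal_mul (by positivity), hC, mul_pow, mul_pow,
        hMp, ← Real.rpow_natCast ((T : ℝ) ^ _), ← Real.rpow_mul hT'.le]
      congr 1
      rw [show (H - 2 / (p : ℝ) - h) * p = p * (H - h) - 2 by field_simp; ring]
      ring
    _ = _ := by rw [ENNReal.ofReal_toReal hAt]

/-! ### Measurability and the expected energy -/

/-- A process with a.e. measurable variables and almost surely continuous paths agrees almost
surely, at all times at once, with a process whose variables are measurable and whose paths
are all continuous. -/
theorem exists_measurable_continuous_version {Ω : Type*} [MeasurableSpace Ω] {P : Measure Ω}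
    {B : ℝ≥0 → Ω → ℝ} (hm : ∀ t, AEMeasurable (B t) P)
    (hc : ∀ᵐ ω ∂P, Continuous fun t => B t ω) :
    ∃ X : ℝ≥0 → Ω → ℝ, (∀ t, Measurable (X t)) ∧ (∀ ω, Continuous fun t => X t ω) ∧
      ∀ᵐ ω ∂P, ∀ t, X t ω = B t ω := by
  classical
  let q := TopologicalSpace.denseSeq ℝ≥0
  have hgood : ∀ᵐ ω ∂P, (Continuous fun t => B t ω) ∧
      ∀ n, B (q n) ω = (hm (q n)).mk (B (q n)) ω :=
    hc.and (ae_all_iff.2 fun n => (hm (q n)).ae_eq_mk)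
  set N := toMeasurable P {ω | ¬ ((Continuous fun t => B t ω) ∧
      ∀ n, B (q n) ω = (hm (q n)).mk (B (q n)) ω)} with hN
  have hNm : MeasurableSet N := measurableSet_toMeasurable _ _
  have hN0 : P N = 0 := by rw [hN, measure_toMeasurable]; exact hgood
  have hNg : ∀ ω ∉ N, (Continuous fun t => B t ω) ∧
      ∀ n, B (q n) ω = (hm (q n)).mk (B (q n)) ω := by
    intro ω hω
    by_contra h
    exact hω (subset_toMeasurable _ _ h)
  -- off the null set `N` the path is continuous and given at the times `q n` by measurable functions
  let X : ℝ≥0 → Ω → ℝ := fun t ω => if ω ∈ N then 0 else B t ω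
  have hXc : ∀ ω, Continuous fun t => X t ω := by
    intro ω
    by_cases h : ω ∈ N
    · simp only [X, h, if_true]; exact continuous_const
    · simp only [X, h, if_false]; exact (hNg ω h).1
  have hXq : ∀ n, Measurable (X (q n)) := by
    intro n
    have : X (q n) = fun ω => if ω ∈ N then 0 else (hm (q n)).mk (B (q n)) ω := by
      ext ω
      by_cases h : ω ∈ N
      · simp [X, h]
      · simp [X, h, (hNg ω h).2 n]
    rw [this]
    exact Measurable.ite hNm measurable_const (hm (q n)).measurable_mk
  refine ⟨X, fun t => ?_, hXc, ?_⟩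
  · obtain ⟨v, hv, hvt⟩ := mem_closure_iff_seq_limit.1
      ((TopologicalSpace.denseRange_denseSeq ℝ≥0) t)
    refine measurable_of_tendsto_metrizable (f := fun n => X (v n)) (fun n => ?_)
      (tendsto_pi_nhds.2 fun ω => ((hXc ω).tendsto t).comp hvt)
    obtain ⟨k, hk⟩ := hv n
    rw [← hk]
    exact hXq k
  · filter_upwards [measure_eq_zero_iff_ae_notMem.1 hN0] with ω hω t
    simp [X, hω]

/-- For a continuous path, the Hölder norm is a countable supremum: off the diagonal the quotient
is continuous, and on the diagonal it vanishes. -/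
theorem holderNorm_eq_iSup_of_denseRange {f : ℝ≥0 → ℝ} (hf : Continuous f) {T : ℝ≥0} {h : ℝ}
    (hh : 0 < h) {q : ℕ → Set.Icc 0 T} (hq : DenseRange q) :
    holderNorm f T h = ⨆ (m : ℕ) (n : ℕ),
      ENNReal.ofReal (|f (q n) - f (q m)| / |((q n : ℝ≥0) : ℝ) - (q m : ℝ≥0)| ^ h) := by
  let F : Set.Icc 0 T × Set.Icc 0 T → ℝ≥0∞ := fun z =>
    ENNReal.ofReal (|f z.2 - f z.1| / |((z.2 : ℝ≥0) : ℝ) - (z.1 : ℝ≥0)| ^ h)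
  let U : Set (Set.Icc 0 T × Set.Icc 0 T) := {z | z.1 ≠ z.2}
  have hU : IsOpen U := isOpen_ne_fun continuous_fst continuous_snd
  have hF : ContinuousOn F U := by
    refine ENNReal.continuous_ofReal.comp_continuousOn (ContinuousOn.div ?_ ?_ ?_)
    · exact Continuous.continuousOn (by fun_prop)
    · refine Continuous.continuousOn (Continuous.rpow_const (by fun_prop) fun _ => Or.inr hh.le)
    · intro z hz
      have : ((z.2 : ℝ≥0) : ℝ) ≠ (z.1 : ℝ≥0) := fun e => hz (Subtype.ext (NNReal.eq e.symm))
      have : 0 < |((z.2 : ℝ≥0) : ℝ) - (z.1 : ℝ≥0)| := abs_pos.2 (sub_ne_zero.2 this)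
      positivity
  apply le_antisymm
  · refine iSup₂_le fun s hs => iSup₂_le fun t ht => ?_
    by_contra! hlt
    set S := ⨆ (m : ℕ) (n : ℕ), F (q m, q n) with hS
    change S < F (⟨s, hs⟩, ⟨t, ht⟩) at hlt
    have hne : ((⟨s, hs⟩, ⟨t, ht⟩) : Set.Icc 0 T × Set.Icc 0 T) ∈ U := by
      intro e
      have e' : s = t := congrArg Subtype.val e
      subst e'
      simp [F] at hlt
    have hopen : IsOpen (U ∩ F ⁻¹' Set.Ioi S) := hF.isOpen_inter_preimage hU isOpen_Ioi
    obtain ⟨⟨m, n⟩, hmn⟩ := (hq.prodMap hq).exists_mem_open hopen ⟨_, hne, hlt⟩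
    exact absurd (le_iSup₂ (f := fun m n => F (q m, q n)) m n) (not_le.2 hmn.2)
  · refine iSup₂_le fun m n => ?_
    exact le_iSup₂_of_le (q m : ℝ≥0) (q m).2 (le_iSup₂_of_le (q n : ℝ≥0) (q n).2 le_rfl)

theorem measurable_holderNorm {Ω : Type*} [MeasurableSpace Ω] {X : ℝ≥0 → Ω → ℝ}
    (hX : ∀ t, Measurable (X t)) (hc : ∀ ω, Continuous fun t => X t ω) (T : ℝ≥0) {h : ℝ}
    (hh : 0 < h) : Measurable fun ω => holderNorm (fun t => X t ω) T h := by
  have : Nonempty (Set.Icc 0 T) := ⟨⟨0, le_rfl, zero_le⟩⟩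
  obtain ⟨q, hq⟩ := TopologicalSpace.exists_dense_seq (Set.Icc 0 T)
  simp_rw [fun ω => holderNorm_eq_iSup_of_denseRange (hc ω) hh hq]
  refine Measurable.iSup fun m => Measurable.iSup fun n => ?_
  have := hX (q n)
  have := hX (q m)
  fun_prop

theorem lintegral_slobodeckijEnergy_le {Ω : Type*} [MeasurableSpace Ω] {P : Measure Ω} [SFinite P]
    {X : ℝ≥0 → Ω → ℝ} (hX : ∀ t, Measurable (X t)) (hc : ∀ ω, Continuous fun t => X t ω)
    {H c : ℝ} {p : ℕ} (hp : 1 ≤ p) (T : ℝ≥0)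
    (hmom : ∀ s t : ℝ≥0, ∫⁻ ω, ENNReal.ofReal (|X t ω - X s ω| ^ p) ∂P ≤
      ENNReal.ofReal (|(t : ℝ) - s| ^ ((p : ℝ) * H) * c)) :
    ∫⁻ ω, slobodeckijEnergy (fun x => X x.toNNReal ω) T p H ∂P ≤
      ENNReal.ofReal ((T : ℝ) ^ 2 * c) := by
  have hXm : Measurable (Function.uncurry X) := measurable_uncurry_of_continuous_of_measurable hc hX
  have hG : Measurable fun z : ℝ × ℝ × Ω => ENNReal.ofReal
      (|X z.1.toNNReal z.2.2 - X z.2.1.toNNReal z.2.2| ^ p / |z.1 - z.2.1| ^ ((p : ℝ) * H)) := by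
    have h1 : Measurable fun z : ℝ × ℝ × Ω => X z.1.toNNReal z.2.2 :=
      hXm.comp (by fun_prop : Measurable fun z : ℝ × ℝ × Ω => (z.1.toNNReal, z.2.2))
    have h2 : Measurable fun z : ℝ × ℝ × Ω => X z.2.1.toNNReal z.2.2 :=
      hXm.comp (by fun_prop : Measurable fun z : ℝ × ℝ × Ω => (z.2.1.toNNReal, z.2.2))
    fun_prop
  have hpt : ∀ x ∈ Set.Icc (0 : ℝ) T, ∀ y ∈ Set.Icc (0 : ℝ) T, ∫⁻ ω, ENNReal.ofReal
      (|X x.toNNReal ω - X y.toNNReal ω| ^ p / |x - y| ^ ((p : ℝ) * H)) ∂P ≤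
        ENNReal.ofReal c := by
    intro x hx y hy
    rcases eq_or_ne x y with rfl | hxy
    · simp [zero_pow (by omega : p ≠ 0)]
    have hd : 0 < |x - y| ^ ((p : ℝ) * H) :=
      Real.rpow_pos_of_pos (abs_pos.2 (sub_ne_zero.2 hxy)) _
    have h := hmom y.toNNReal x.toNNReal
    rw [Real.coe_toNNReal _ hx.1, Real.coe_toNNReal _ hy.1] at h
    simp_rw [div_eq_inv_mul, ENNReal.ofReal_mul (inv_nonneg.2 hd.le)]
    rw [lintegral_const_mul' _ _ ENNReal.ofReal_ne_top]
    refine (mul_le_mul_right h _).trans_eq ?_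
    rw [← ENNReal.ofReal_mul (inv_nonneg.2 hd.le), inv_mul_cancel_left₀ hd.ne']
  unfold slobodeckijEnergy
  rw [lintegral_lintegral_swap]
  · calc _ = ∫⁻ x in Set.Icc (0 : ℝ) T, ∫⁻ y in Set.Icc (0 : ℝ) T, ∫⁻ ω, ENNReal.ofReal
          (|X x.toNNReal ω - X y.toNNReal ω| ^ p / |x - y| ^ ((p : ℝ) * H)) ∂P := by
          refine lintegral_congr fun x => ?_
          rw [lintegral_lintegral_swap]
          exact (hG.comp (by fun_prop : Measurable fun z : Ω × ℝ => (x, z.2, z.1))).aemeasurable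
      _ ≤ ∫⁻ x in Set.Icc (0 : ℝ) T, ∫⁻ y in Set.Icc (0 : ℝ) T, ENNReal.ofReal c :=
          setLIntegral_mono' measurableSet_Icc fun x hx =>
            setLIntegral_mono' measurableSet_Icc fun y hy => hpt x hx y hy
      _ = _ := by
          simp only [setLIntegral_const, Real.volume_Icc, sub_zero]
          rw [ENNReal.ofReal_mul (by positivity), ENNReal.ofReal_pow (by positivity)]
          ring
  · have hj : Measurable fun w : (Ω × ℝ) × ℝ => ENNReal.ofReal
        (|X w.1.2.toNNReal w.1.1 - X w.2.toNNReal w.1.1| ^ p / |w.1.2 - w.2| ^ ((p : ℝ) * H)) :=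
      Measurable.comp (g := fun z : ℝ × ℝ × Ω => ENNReal.ofReal
        (|X z.1.toNNReal z.2.2 - X z.2.1.toNNReal z.2.2| ^ p / |z.1 - z.2.1| ^ ((p : ℝ) * H)))
        (f := fun w : (Ω × ℝ) × ℝ => (w.1.2, w.2, w.1.1)) hG (by fun_prop)
    have hj' := hj.lintegral_prod_right' (ν := volume.restrict (Set.Icc (0 : ℝ) T))
    exact hj'.aemeasurable

/-! ### Exponential moments from power moments -/

/-- The even terms are those of `exp (K ^ 2 / 2)`, and each odd term is at most `K` times the even
term before it. -/
theorem exists_hasSum_pow_div_doubleFactorial {K : ℝ} (hK : 0 ≤ K) :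
    ∃ S, HasSum (fun n : ℕ => K ^ n / (n ‼ : ℕ)) S ∧ S ≤ (1 + K) * Real.exp (K ^ 2 / 2) := by
  have hexp : HasSum (fun k : ℕ => (K ^ 2 / 2) ^ k / (k ! : ℕ)) (Real.exp (K ^ 2 / 2)) := by
    rw [Real.exp_eq_exp_ℝ]
    exact NormedSpace.expSeries_div_hasSum_exp (K ^ 2 / 2)
  have hev : ∀ k : ℕ, K ^ (2 * k) / ((2 * k) ‼ : ℕ) = (K ^ 2 / 2) ^ k / (k ! : ℕ) := by
    intro k
    rw [Nat.doubleFactorial_two_mul, pow_mul, div_pow]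
    push_cast
    rw [div_div]
  have hodd : ∀ k : ℕ, K ^ (2 * k + 1) / ((2 * k + 1) ‼ : ℕ) ≤
      K * ((K ^ 2 / 2) ^ k / (k ! : ℕ)) := by
    intro k
    have hle : (2 * k) ‼ ≤ (2 * k + 1) ‼ := by
      induction k with
      | zero => simp
      | succ k ih =>
        rw [show 2 * (k + 1) = 2 * k + 2 by ring, show 2 * k + 2 + 1 = 2 * k + 1 + 2 by ring,
          Nat.doubleFactorial_add_two, Nat.doubleFactorial_add_two]
        exact Nat.mul_le_mul (by omega) ih
    rw [← hev, pow_succ', mul_div_assoc]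
    have : (0 : ℝ) < ((2 * k) ‼ : ℕ) := by exact_mod_cast Nat.doubleFactorial_pos _
    gcongr
  have hsodd : Summable fun k : ℕ => K ^ (2 * k + 1) / ((2 * k + 1) ‼ : ℕ) :=
    Summable.of_nonneg_of_le (fun k => by positivity) hodd (hexp.summable.mul_left K)
  have hseven : HasSum (fun k : ℕ => K ^ (2 * k) / ((2 * k) ‼ : ℕ)) (Real.exp (K ^ 2 / 2)) := by
    simpa only [hev] using hexp
  refine ⟨_, HasSum.even_add_odd (f := fun n : ℕ => K ^ n / (n ‼ : ℕ)) hseven hsodd.hasSum, ?_⟩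
  have := hsodd.tsum_le_tsum hodd (hexp.summable.mul_left K)
  rw [tsum_mul_left, hexp.tsum_eq] at this
  linarith

theorem doubleFactorial_pred_div_factorial (n : ℕ) :
    (((n - 1) ‼ : ℕ) : ℝ) / (n ! : ℕ) = 1 / (n ‼ : ℕ) := by
  cases n with
  | zero => simp
  | succ n =>
    have h1 : ((n ‼ : ℕ) : ℝ) ≠ 0 := by exact_mod_cast (Nat.doubleFactorial_pos n).ne'
    have h2 : (((n + 1) ‼ : ℕ) : ℝ) ≠ 0 := by exact_mod_cast (Nat.doubleFactorial_pos (n + 1)).ne'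
    rw [Nat.factorial_eq_mul_doubleFactorial, Nat.add_sub_cancel]
    push_cast
    field_simp

/-- Gaussian-type bounds on the moments of order `n > m` bound the exponential moment. The moments
of order at most `m` are controlled by the one of order `m + 1`. -/
theorem lintegral_exp_le_of_moments {Ω : Type*} [MeasurableSpace Ω] {P : Measure Ω}
    [IsProbabilityMeasure P] {Y : Ω → ℝ} (hY : AEMeasurable Y P) (hY0 : ∀ ω, 0 ≤ Y ω) {K : ℝ}
    (hK : 0 < K) {m : ℕ}
    (hmom : ∀ n, m < n → ∫⁻ ω, ENNReal.ofReal (Y ω ^ n) ∂P ≤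
      ENNReal.ofReal (K ^ n * ((n - 1) ‼ : ℕ))) :
    ∫⁻ ω, ENNReal.ofReal (Real.exp (Y ω)) ∂P ≤
      ENNReal.ofReal ((1 + (m ‼ : ℕ)) * Real.exp K + (1 + K) * Real.exp (K ^ 2 / 2)) := by
  obtain ⟨S, hS, hSle⟩ := exists_hasSum_pow_div_doubleFactorial hK.le
  have hexp (x : ℝ) : HasSum (fun n : ℕ => x ^ n / (n ! : ℕ)) (Real.exp x) := by
    rw [Real.exp_eq_exp_ℝ]
    exact NormedSpace.expSeries_div_hasSum_exp x
  have hlow : ∀ n, n ≤ m → ∫⁻ ω, ENNReal.ofReal (Y ω ^ n) ∂P ≤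
      ENNReal.ofReal (K ^ n * (1 + (m ‼ : ℕ))) := by
    intro n hn
    have hpt : ∀ ω, ENNReal.ofReal (Y ω ^ n) ≤ ENNReal.ofReal (K ^ n) *
        (1 + ENNReal.ofReal ((K ^ (m + 1))⁻¹) * ENNReal.ofReal (Y ω ^ (m + 1))) := by
      intro ω
      rw [← ENNReal.ofReal_mul (by positivity), ← ENNReal.ofReal_one,
        ← ENNReal.ofReal_add (by norm_num)
          (mul_nonneg (by positivity) (pow_nonneg (hY0 ω) _)), ← ENNReal.ofReal_mul (by positivity)]
      apply ENNReal.ofReal_le_ofReal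
      have h0 : 0 ≤ Y ω / K := div_nonneg (hY0 ω) hK.le
      have h1 : (Y ω / K) ^ n ≤ 1 + (Y ω / K) ^ (m + 1) := by
        rcases le_total (Y ω / K) 1 with h | h
        · have := pow_le_one₀ h0 h (n := n)
          have := pow_nonneg h0 (m + 1)
          linarith
        · have := pow_le_pow_right₀ h (by omega : n ≤ m + 1)
          linarith
      calc Y ω ^ n = K ^ n * (Y ω / K) ^ n := by rw [div_pow]; field_simp
        _ ≤ K ^ n * (1 + (Y ω / K) ^ (m + 1)) := by gcongr
        _ = _ := by rw [div_pow, div_eq_inv_mul]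
    calc _ ≤ ∫⁻ ω, ENNReal.ofReal (K ^ n) *
        (1 + ENNReal.ofReal ((K ^ (m + 1))⁻¹) * ENNReal.ofReal (Y ω ^ (m + 1))) ∂P :=
          lintegral_mono hpt
      _ = ENNReal.ofReal (K ^ n) * (1 + ENNReal.ofReal ((K ^ (m + 1))⁻¹) *
            ∫⁻ ω, ENNReal.ofReal (Y ω ^ (m + 1)) ∂P) := by
          rw [lintegral_const_mul' _ _ ENNReal.ofReal_ne_top, lintegral_add_left measurable_const,
            lintegral_const_mul' _ _ ENNReal.ofReal_ne_top]
          simp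
      _ ≤ ENNReal.ofReal (K ^ n) * (1 + ENNReal.ofReal ((K ^ (m + 1))⁻¹) *
            ENNReal.ofReal (K ^ (m + 1) * (m ‼ : ℕ))) := by
          gcongr
          exact hmom (m + 1) (Nat.lt_succ_self m)
      _ = _ := by
          rw [← ENNReal.ofReal_mul (by positivity), inv_mul_cancel_left₀ (by positivity),
            ← ENNReal.ofReal_one, ← ENNReal.ofReal_add (by norm_num) (by positivity),
            ← ENNReal.ofReal_mul (by positivity)]
  set c : ℕ → ℝ := fun n => (1 + (m ‼ : ℕ)) * (K ^ n / (n ! : ℕ)) + K ^ n / (n ‼ : ℕ) with hc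
  have hc0 : ∀ n, 0 ≤ c n := fun n => by positivity
  have hcsum : HasSum c ((1 + (m ‼ : ℕ)) * Real.exp K + S) := ((hexp K).mul_left _).add hS
  have hterm : ∀ n, ∫⁻ ω, ENNReal.ofReal (Y ω ^ n / (n ! : ℕ)) ∂P ≤ ENNReal.ofReal (c n) := by
    intro n
    have hn : (0 : ℝ) ≤ ((n ! : ℕ) : ℝ)⁻¹ := by positivity
    simp_rw [div_eq_inv_mul (Y _ ^ n), ENNReal.ofReal_mul hn]
    rw [lintegral_const_mul' _ _ ENNReal.ofReal_ne_top]
    rcases le_or_gt n m with h | h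
    · refine (mul_le_mul_right (hlow n h) _).trans ?_
      rw [← ENNReal.ofReal_mul hn]
      apply ENNReal.ofReal_le_ofReal
      have : 0 ≤ K ^ n / (n ‼ : ℕ) := by positivity
      calc _ = (1 + (m ‼ : ℕ)) * (K ^ n / (n ! : ℕ)) := by ring
        _ ≤ _ := by rw [hc]; linarith
    · refine (mul_le_mul_right (hmom n h) _).trans ?_
      rw [← ENNReal.ofReal_mul hn]
      apply ENNReal.ofReal_le_ofReal
      have : 0 ≤ (1 + (m ‼ : ℕ)) * (K ^ n / (n ! : ℕ)) := by positivity
      calc _ = K ^ n * ((((n - 1) ‼ : ℕ) : ℝ) / (n ! : ℕ)) := by ring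
        _ = K ^ n / (n ‼ : ℕ) := by rw [doubleFactorial_pred_div_factorial]; ring
        _ ≤ _ := by rw [hc]; linarith
  calc ∫⁻ ω, ENNReal.ofReal (Real.exp (Y ω)) ∂P
      = ∫⁻ ω, ∑' n : ℕ, ENNReal.ofReal (Y ω ^ n / (n ! : ℕ)) ∂P := by
        refine lintegral_congr fun ω => ?_
        rw [← ENNReal.ofReal_tsum_of_nonneg (fun n => div_nonneg (pow_nonneg (hY0 ω) n)
          (by positivity)) (hexp _).summable, (hexp _).tsum_eq]
    _ = ∑' n : ℕ, ∫⁻ ω, ENNReal.ofReal (Y ω ^ n / (n ! : ℕ)) ∂P :=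
        lintegral_tsum fun n => by fun_prop
    _ ≤ ∑' n : ℕ, ENNReal.ofReal (c n) := ENNReal.tsum_le_tsum hterm
    _ = ENNReal.ofReal ((1 + (m ‼ : ℕ)) * Real.exp K + S) := by
        rw [← ENNReal.ofReal_tsum_of_nonneg hc0 hcsum.summable, hcsum.tsum_eq]
    _ ≤ _ := ENNReal.ofReal_le_ofReal (by linarith)

theorem integrable_and_integral_le_of_lintegral_le {Ω : Type*} [MeasurableSpace Ω] {P : Measure Ω}
    {Y : Ω → ℝ} (hY : AEMeasurable Y P) (hY0 : ∀ ω, 0 ≤ Y ω) {C : ℝ} (hC : 0 ≤ C)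
    (h : ∫⁻ ω, ENNReal.ofReal (Y ω) ∂P ≤ ENNReal.ofReal C) :
    Integrable Y P ∧ ∫ ω, Y ω ∂P ≤ C := by
  refine ⟨⟨hY.aestronglyMeasurable, ?_⟩, ?_⟩
  · rw [hasFiniteIntegral_iff_ofReal (by filter_upwards with ω using hY0 ω)]
    exact h.trans_lt ENNReal.ofReal_lt_top
  · rw [integral_eq_lintegral_of_nonneg_ae (by filter_upwards with ω using hY0 ω)
      hY.aestronglyMeasurable]
    exact ENNReal.toReal_le_of_le_ofReal hC h

/-! ### Fractional Brownian motion -/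

namespace IsFractionalBrownianMotion

variable {Ω : Type*} [MeasurableSpace Ω] {P : Measure Ω} {B : ℝ≥0 → Ω → ℝ} {H : ℝ}

theorem lintegral_abs_sub_pow_le (hB : IsFractionalBrownianMotion B H P) (p : ℕ) (s t : ℝ≥0) :
    ∫⁻ ω, ENNReal.ofReal (|B t ω - B s ω| ^ p) ∂P ≤
      ENNReal.ofReal (|(t : ℝ) - s| ^ ((p : ℝ) * H) * ((p - 1) ‼ : ℕ)) := by
  have hi (t : ℝ≥0) : Integrable (B t) P := (hB.isGaussianProcess.hasGaussianLaw_eval t).integrable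
  have h := lintegral_abs_pow_le_of_hasGaussianLaw
    (hB.isGaussianProcess.hasGaussianLaw_fun_sub (s := t) (t := s))
    (by rw [integral_sub (hi t) (hi s), hB.centered, hB.centered, sub_zero])
    (σ := |(t : ℝ) - s| ^ H) (by positivity)
    (by rw [hB.integral_sq_sub s t, ← Real.rpow_natCast, ← Real.rpow_mul (abs_nonneg _)]
        congr 1; push_cast; ring) p
  rwa [← Real.rpow_natCast (|(t : ℝ) - s| ^ H), ← Real.rpow_mul (abs_nonneg _), mul_comm H] at h

theorem aemeasurable_holderNorm (hB : IsFractionalBrownianMotion B H P) (T : ℝ≥0) {h : ℝ}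
    (hh : 0 < h) : AEMeasurable (fun ω => holderNorm (fun t => B t ω) T h) P := by
  obtain ⟨X, hX, hc, hXB⟩ := exists_measurable_continuous_version
    (fun t => hB.isGaussianProcess.aemeasurable t) hB.continuous_paths
  refine ⟨_, measurable_holderNorm hX hc T hh, ?_⟩
  filter_upwards [hXB] with ω hω
  simp only [hω]

theorem lintegral_holderNorm_pow_le [SFinite P] (hB : IsFractionalBrownianMotion B H P)
    {T : ℝ≥0} (hT : 0 < T) {h : ℝ} (hh : 0 < h) (hhH : h < H) {p : ℕ} (hp : 2 / (H - h) < p) :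
    ∫⁻ ω, holderNorm (fun t => B t ω) T h ^ p ∂P ≤
      ENNReal.ofReal ((8 * (H / h)) ^ p * (T : ℝ) ^ ((p : ℝ) * (H - h)) * ((p - 1) ‼ : ℕ)) := by
  obtain ⟨X, hX, hc, hXB⟩ := exists_measurable_continuous_version
    (fun t => hB.isGaussianProcess.aemeasurable t) hB.continuous_paths
  have hHh : 0 < H - h := sub_pos.2 hhH
  have hT' : (0 : ℝ) < T := by exact_mod_cast hT
  have hp1 : 1 ≤ p := by
    have : (0 : ℝ) < p := lt_trans (by positivity) hp
    exact_mod_cast this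
  have hH : 0 < H := hh.trans hhH
  have hE := lintegral_slobodeckijEnergy_le (P := P) hX hc (H := H) (c := ((p - 1) ‼ : ℕ)) hp1 T
    fun s t => by
      refine le_trans (lintegral_congr_ae ?_).le (hB.lintegral_abs_sub_pow_le p s t)
      filter_upwards [hXB] with ω hω
      simp only [hω]
  calc _ = ∫⁻ ω, holderNorm (fun t => X t ω) T h ^ p ∂P := by
        refine lintegral_congr_ae ?_
        filter_upwards [hXB] with ω hω
        simp only [hω]
    _ ≤ ∫⁻ ω, ENNReal.ofReal ((8 * (H / h)) ^ p * (T : ℝ) ^ ((p : ℝ) * (H - h) - 2)) *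
        slobodeckijEnergy (fun x => X x.toNNReal ω) T p H ∂P :=
        lintegral_mono fun ω => holderNorm_pow_le (hc ω) hT hh hhH hp
    _ ≤ ENNReal.ofReal ((8 * (H / h)) ^ p * (T : ℝ) ^ ((p : ℝ) * (H - h) - 2)) *
        ENNReal.ofReal ((T : ℝ) ^ 2 * ((p - 1) ‼ : ℕ)) := by
        rw [lintegral_const_mul' _ _ ENNReal.ofReal_ne_top]
        gcongr
    _ = _ := by
        rw [← ENNReal.ofReal_mul (by positivity), Real.rpow_sub hT', Real.rpow_two]
        congr 1
        field_simp

end IsFractionalBrownianMotion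

theorem lemmaA1 {Ω : Type*} [MeasurableSpace Ω] (P : Measure Ω) [IsProbabilityMeasure P]
    (H h : ℝ) (hh : 0 < h) (hhH : h < H) (hH : H < 1)
    (B : ℝ≥0 → Ω → ℝ) (hB : IsFractionalBrownianMotion B H P) :
    -- the Hölder norm is almost surely finite
    (∀ T : ℝ≥0, 0 < T → ∀ᵐ ω ∂P, holderNorm (fun t => B t ω) T h ≠ ∞) ∧
    -- exponential moment
    (∀ T : ℝ≥0, (h / (8 * H)) ^ (1 / (H - h)) < (T : ℝ) →
      Integrable (fun ω => Real.exp (holderNorm (fun t => B t ω) T h).toReal) P ∧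
      ∫ ω, Real.exp (holderNorm (fun t => B t ω) T h).toReal ∂P ≤
        (((⌊2 / (H - h)⌋₊ ‼ : ℕ) : ℝ) + 16 * H / h) * (1 + (T : ℝ) ^ (H - h)) *
          Real.exp (128 * H ^ 2 / h ^ 2 * (T : ℝ) ^ (2 * (H - h)))) ∧
    -- moments of integer order `p > [2 / (H - h)]`
    (∀ T : ℝ≥0, 0 < T → ∀ p : ℕ, ⌊2 / (H - h)⌋₊ < p →
      Integrable (fun ω => (holderNorm (fun t => B t ω) T h).toReal ^ p) P ∧
      ∫ ω, (holderNorm (fun t => B t ω) T h).toReal ^ p ∂P ≤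
        (16 * (H / h)) ^ p * (T : ℝ) ^ ((p : ℝ) * (H - h)) * (((p - 1) ‼ : ℕ) : ℝ)) := by
  have hHh : 0 < H - h := sub_pos.2 hhH
  have hH0 : 0 < H := hh.trans hhH
  have hfin : ∀ T : ℝ≥0, 0 < T → ∀ᵐ ω ∂P, holderNorm (fun t => B t ω) T h ≠ ∞ := by
    intro T hT
    have hmom := hB.lintegral_holderNorm_pow_le hT hh hhH
      (p := ⌊2 / (H - h)⌋₊ + 1) (by exact_mod_cast Nat.lt_floor_add_one (2 / (H - h)))
    have hlt := ae_lt_top' ((hB.aemeasurable_holderNorm T hh).pow_const _)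
      (hmom.trans_lt ENNReal.ofReal_lt_top).ne
    filter_upwards [hlt] with ω hω htop
    simp [htop] at hω
  have hmeas : ∀ T : ℝ≥0, AEMeasurable (fun ω => (holderNorm (fun t => B t ω) T h).toReal) P :=
    fun T => (hB.aemeasurable_holderNorm T hh).ennreal_toReal
  have hmom : ∀ T : ℝ≥0, 0 < T → ∀ p : ℕ, ⌊2 / (H - h)⌋₊ < p →
      ∫⁻ ω, ENNReal.ofReal ((holderNorm (fun t => B t ω) T h).toReal ^ p) ∂P ≤
        ENNReal.ofReal ((16 * (H / h)) ^ p * (T : ℝ) ^ ((p : ℝ) * (H - h)) *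
          (((p - 1) ‼ : ℕ) : ℝ)) := by
    intro T hT p hp
    have hp' : 2 / (H - h) < p := (Nat.floor_lt (by positivity)).1 hp
    calc _ = ∫⁻ ω, holderNorm (fun t => B t ω) T h ^ p ∂P := by
          refine lintegral_congr_ae ?_
          filter_upwards [hfin T hT] with ω hω
          rw [ENNReal.ofReal_pow ENNReal.toReal_nonneg, ENNReal.ofReal_toReal hω]
      _ ≤ _ := hB.lintegral_holderNorm_pow_le hT hh hhH hp'
      _ ≤ _ := by
          apply ENNReal.ofReal_le_ofReal
          gcongr
          norm_num
  refine ⟨hfin, fun T hT => ?_, fun T hT p hp => ?_⟩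
  · have hT' : (0 : ℝ) < T := lt_trans (by positivity) hT
    have hT0 : 0 < T := by exact_mod_cast hT'
    set K : ℝ := 16 * (H / h) * (T : ℝ) ^ (H - h) with hK
    have hK0 : 0 < K := by positivity
    -- the lower bound on `T` says exactly that `K` exceeds `2`, so that `K ≤ K ^ 2 / 2`
    have hK2 : 2 < K := by
      have h1 := Real.rpow_lt_rpow (by positivity) hT hHh
      rw [← Real.rpow_mul (by positivity), one_div_mul_cancel hHh.ne', Real.rpow_one,
        div_lt_iff₀ (by positivity)] at h1
      have h2 : K * h = 16 * H * (T : ℝ) ^ (H - h) := by rw [hK]; field_simp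
      nlinarith
    have hexp := lintegral_exp_le_of_moments (hmeas T) (fun ω => ENNReal.toReal_nonneg) hK0
      (m := ⌊2 / (H - h)⌋₊) fun n hn => by
        refine (hmom T hT0 n hn).trans_eq ?_
        rw [hK, mul_pow _ ((T : ℝ) ^ (H - h)),
          ← Real.rpow_natCast ((T : ℝ) ^ (H - h)), ← Real.rpow_mul hT'.le, mul_comm (H - h)]
    have hsq : 128 * H ^ 2 / h ^ 2 * (T : ℝ) ^ (2 * (H - h)) = K ^ 2 / 2 := by
      rw [hK, mul_comm 2 (H - h), Real.rpow_mul hT'.le, Real.rpow_two]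
      field_simp
      ring
    have hHh1 : 1 ≤ H / h := (one_le_div hh).2 hhH.le
    rw [hsq]
    refine integrable_and_integral_le_of_lintegral_le (hmeas T).exp (fun ω => (Real.exp_pos _).le)
      (by positivity) (hexp.trans (ENNReal.ofReal_le_ofReal ?_))
    set D : ℝ := ((⌊2 / (H - h)⌋₊ ‼ : ℕ) : ℝ) with hD
    have hD0 : 0 ≤ D := by positivity
    have hKe : Real.exp K ≤ Real.exp (K ^ 2 / 2) := Real.exp_le_exp.2 (by nlinarith)
    calc (1 + D) * Real.exp K + (1 + K) * Real.exp (K ^ 2 / 2)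
        ≤ (1 + D) * Real.exp (K ^ 2 / 2) + (1 + K) * Real.exp (K ^ 2 / 2) := by gcongr
      _ = (D + 2 + K) * Real.exp (K ^ 2 / 2) := by ring
      _ ≤ _ := by
          gcongr
          have hTD : 0 ≤ D * (T : ℝ) ^ (H - h) := by positivity
          calc D + 2 + K ≤ D + 16 * (H / h) + K + D * (T : ℝ) ^ (H - h) := by linarith
            _ = (D + 16 * H / h) * (1 + (T : ℝ) ^ (H - h)) := by rw [hK]; ring
  · exact integrable_and_integral_le_of_lintegral_le ((hmeas T).pow_const p)
      (fun ω => pow_nonneg ENNReal.toReal_nonneg p) (by positivity) (hmom T hT p hp)
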